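/- Lemma (PAC-Bayes bound for centralized SGD). Setting. Let $n$ clients hold datasets of sizes $N_1,\dots,N_n$ with average size $m=\frac1n\sum_{i=1}^n N_i>0$. All $nm$ data are drawn i.i.d. from a probability distribution $\mathcal D$ and together form the centralized training set $s$. Let $F(\theta;z)\in[0,1]$, $\theta\in\mathbb R^d$, be a measurable loss. For a probability distribution $Q$ on $\mathbb R^d$ put $$R(Q)=\mathbb E_{\theta\sim Q}\,\mathbb E_{z\sim\mathcal D}F(\theta;z),\qquad \hat R(Q)=\mathbb E_{\theta\sim Q}\,\frac1{nm}\sum_{z\in s}F(\theta;z).$$ Centralized SGD on $s$ has learning rate $\eta>0$ and batch size $S=k_{Cen}nm$, where $\frac1{nm}\le k_{Cen}\le1$, and is run for $T/n$ rounds, where $T\ge1$ is the number of rounds of federated training. Near a fixed minimum $\theta^*$ (which may be taken to be $0$) the gradient is modelled as $A(\theta-\theta^*)$ with $A$ symmetric positive definite, and the mini-batch gradient noise as centred Gaussian with covariance $\frac1S C$, where $C=BB^\top$ is positive definite; $A,B,C\in\mathbb R^{d\times d}$ may depend on $s$. The training is modelled by the Ornstein–Uhlenbeck process $$\theta_t=\theta^*+e^{-\frac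 TnAt}(\theta_0-\theta^*)+\frac Tn\sqrt{\frac{\eta}{k_{Cen}nm}}\int_0^t e^{-\frac TnA(t-t')}B\,dW(t').$$ Let $Q_{Cen}$ (depending on $s$) be its stationary distribution, let $\Sigma$ be the covariance matrix of $Q_{Cen}$, and assume $A\Sigma=\Sigma A$. The assumptions on $A,B,C,Q_{Cen}$ are made for almost every $s$. Claim. For every $\delta\in(0,1)$, with probability at least $1-\delta$ over the training set $s$, $$R(Q_{Cen})-\hat R(Q_{Cen})\le\sqrt{\frac{H_{Cen}+H'_{Cen}-d+2\log\frac1\delta+2\log(nm)+4}{4nm-2}},$$ where $$H_{Cen}=d\log\Big(\frac{2k_{Cen}n^2m}{T\eta}\Big)-\log\det(CA^{-1}),\qquad H'_{Cen}=\frac{T\eta}{2k_{Cen}n^2m}\,\mathrm{tr}(CA^{-1}).$$ -/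

import Mathlib

open MeasureTheory ProbabilityTheory

noncomputable section

/-- The (noise) covariance at time `t` of an Ornstein–Uhlenbeck process with drift matrix `Γ` and
diffusion matrix `σ`, i.e. the covariance matrix of the Wiener integral
`∫ s in 0..t, exp (-(t - s) Γ) σ dW(s)`. -/
def ouCovariance {d : ℕ} (Γ σ : Matrix (Fin d) (Fin d) ℝ) (t : ℝ) : Matrix (Fin d) (Fin d) ℝ :=
  Matrix.of fun i j => ∫ s in (0 : ℝ)..t,
    (NormedSpace.exp (-(t - s) • Γ) * (σ * σ.transpose)
      * (NormedSpace.exp (-(t - s) • Γ)).transpose) i j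

/-- The law at time `t` of the Ornstein–Uhlenbeck process `dX = -Γ (X - c) dt + σ dW` in `ℝᵈ` whose
initial value `X(0)` has law `Q` and is independent of `W`, that is, the law of
`X(t) = c + exp (-t Γ) (X(0) - c) + ∫ s in 0..t, exp (-(t - s) Γ) σ dW(s)`. -/
def ouLaw {d : ℕ} (c : EuclideanSpace ℝ (Fin d)) (Γ σ : Matrix (Fin d) (Fin d) ℝ) (t : ℝ)
    (Q : Measure (EuclideanSpace ℝ (Fin d))) : Measure (EuclideanSpace ℝ (Fin d)) :=
  (Q.map fun x => c + Matrix.toEuclideanCLM (𝕜 := ℝ) (NormedSpace.exp (-t • Γ)) (x - c))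
    ∗ multivariateGaussian 0 (ouCovariance Γ σ t)

/-- `Q` is a stationary distribution of the Ornstein–Uhlenbeck process
`dX = -Γ (X - c) dt + σ dW`. -/
structure IsOUStationary {d : ℕ} (c : EuclideanSpace ℝ (Fin d)) (Γ σ : Matrix (Fin d) (Fin d) ℝ)
    (Q : Measure (EuclideanSpace ℝ (Fin d))) : Prop where
  isProbabilityMeasure : IsProbabilityMeasure Q
  invariant : ∀ t : ℝ, 0 ≤ t → ouLaw c Γ σ t Q = Q

/-- `Q` is a stationary distribution of SGD with learning rate `η` and batch size `S`, run for `r`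
rounds, near the minimum `θstar`. The full gradient is `A (θ - θstar)`, the gradient noise of a
mini-batch of size `S` is Gaussian with covariance `S⁻¹ B Bᵀ`, and the corresponding diffusion with
the `r`-fold scaling of drift and noise is
`dθ = -r A (θ - θstar) dt + r √(η / S) B dW`. -/
def IsSGDStationary {d : ℕ} (r η S : ℝ) (θstar : EuclideanSpace ℝ (Fin d))
    (A B : Matrix (Fin d) (Fin d) ℝ) (Q : Measure (EuclideanSpace ℝ (Fin d))) : Prop :=
  IsOUStationary θstar (r • A) ((r * √(η / S)) • B) Q

/-- The covariance matrix of a probability distribution on `ℝᵈ`. -/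
def covarianceMatrix {d : ℕ} (Q : Measure (EuclideanSpace ℝ (Fin d))) :
    Matrix (Fin d) (Fin d) ℝ :=
  Matrix.of fun i j => cov[fun θ => θ i, fun θ => θ j; Q]

/-- The expected risk `R(Q)` of a distribution `Q` on parameters for the loss `F` and the data
distribution `𝒟`. -/
def expectedRisk {d : ℕ} {Z : Type*} [MeasurableSpace Z] (F : EuclideanSpace ℝ (Fin d) → Z → ℝ)
    (𝒟 : Measure Z) (Q : Measure (EuclideanSpace ℝ (Fin d))) : ℝ :=
  ∫ θ, ∫ z, F θ z ∂𝒟 ∂Q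

/-- The empirical risk of a distribution `Q` on parameters for the loss `F` and the training
sample `s`, whose data are indexed by a finite type `ι`. -/
def empiricalRisk {d : ℕ} {Z ι : Type*} [Fintype ι] (F : EuclideanSpace ℝ (Fin d) → Z → ℝ)
    (s : ι → Z) (Q : Measure (EuclideanSpace ℝ (Fin d))) : ℝ :=
  ∫ θ, (Fintype.card ι : ℝ)⁻¹ * ∑ i, F θ (s i) ∂Q

/-- The training data of `n` clients, client `i` holding `N i` samples in `Z`; the centralized
training set is the whole family. -/
abbrev TrainingData {n : ℕ} (N : Fin n → ℕ) (Z : Type*) : Type _ :=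
  ((i : Fin n) × Fin (N i)) → Z

end

open Filter
open scoped NNReal ENNReal RealInnerProductSpace MatrixOrder Matrix Topology

/-! Write `M = nm`, and let `Δ s θ` be population risk minus empirical risk at a fixed `θ`. By
Hoeffding's lemma it is sub-Gaussian with variance proxy `1/(4M)`, so `exp ((2M-1) Δ²)` has
expectation at most `√(2M)`. Averaging over the data-independent prior `N(θ*, 1)` and applying
Markov gives, outside an event of probability at most `δ`, a prior exponential moment at most
`√(2M)/δ`. The Donsker–Varadhan inequality transfers this to every nondegenerate Gaussian posterior
`N(θ*, V)` at once, at the cost `KL = (tr V - d - log det V)/2`. Jensen's inequality `(E Δ)² ≤ E Δ²`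
then yields the square root.

It remains to identify the posterior. Letting time tend to infinity in the stationarity equation
forces the law to be `N(θ*, V)`, where `V` solves the Lyapunov equation `ΓV + VΓ = σσᵀ`. Since `A`
commutes with `V`, this gives `V = a A⁻¹C` with `a = Tη/(2kn²m)`. Its trace and log-determinant
produce `H'` and `H`. -/

/-! ### Exponential moments of squared deviations. -/

lemma lintegral_exp_mul_sq_gaussianReal {a : ℝ} (ha : a < 1 / 2) :
    ∫⁻ x, ENNReal.ofReal (Real.exp (a * x ^ 2)) ∂gaussianReal 0 1
      = ENNReal.ofReal (√(1 / (1 - 2 * a))) := by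
  have hb : 0 < 1 / 2 - a := by linarith
  rw [gaussianReal_of_var_ne_zero 0 one_ne_zero,
    lintegral_withDensity_eq_lintegral_mul _ (measurable_gaussianPDF 0 1) (by fun_prop)]
  have h : ∀ x : ℝ, (gaussianPDF 0 1 * fun x : ℝ => ENNReal.ofReal (Real.exp (a * x ^ 2))) x
      = ENNReal.ofReal ((√(2 * Real.pi))⁻¹ * Real.exp (-(1 / 2 - a) * x ^ 2)) := by
    intro x
    rw [Pi.mul_apply, gaussianPDF, gaussianPDFReal, ← ENNReal.ofReal_mul (by positivity),
      mul_assoc, ← Real.exp_add]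
    simp only [NNReal.coe_one, mul_one, sub_zero]
    ring_nf
  simp_rw [h]
  rw [← ofReal_integral_eq_lintegral_ofReal ((integrable_exp_neg_mul_sq hb).const_mul _)
    (ae_of_all _ fun x => by positivity), integral_const_mul, integral_gaussian,
    ← Real.sqrt_inv, ← Real.sqrt_mul (by positivity)]
  congr 2
  have : 1 - 2 * a ≠ 0 := by linarith
  field_simp

/-- The square is linearised by an auxiliary standard Gaussian `g`: `exp (l x²) = E exp (√(2l) g
x)`. After Tonelli the sub-Gaussian bound applies for each fixed `g` and leaves a Gaussian integral
of `exp (l c g²)`. -/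
lemma ProbabilityTheory.HasSubgaussianMGF.lintegral_exp_mul_sq_le {Ω : Type*}
    [MeasurableSpace Ω] {μ : Measure Ω} [SFinite μ] {X : Ω → ℝ} {c : ℝ≥0}
    (h : HasSubgaussianMGF X c μ)
    (hX : Measurable X) {l : ℝ} (hl : 0 ≤ l) (hlc : 2 * l * c < 1) :
    ∫⁻ ω, ENNReal.ofReal (Real.exp (l * X ω ^ 2)) ∂μ
      ≤ ENNReal.ofReal (√(1 / (1 - 2 * (l * c)))) := by
  have h1 : ∀ x : ℝ, ENNReal.ofReal (Real.exp (l * x ^ 2))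
      = ∫⁻ g, ENNReal.ofReal (Real.exp ((√(2 * l) * g) * x)) ∂gaussianReal 0 1 := by
    intro x
    have e : ∀ g : ℝ, (√(2 * l) * g) * x = (√(2 * l) * x) * g := fun g => by ring
    simp_rw [e]
    rw [← ofReal_integral_eq_lintegral_ofReal (integrable_exp_mul_gaussianReal _)
      (ae_of_all _ fun x => by positivity)]
    have := congrFun (mgf_id_gaussianReal (μ := 0) (v := 1)) (√(2 * l) * x)
    simp only [mgf, id] at this
    rw [this, mul_pow, Real.sq_sqrt (by positivity)]
    congr 2
    simp
    ring
  simp_rw [h1]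
  rw [lintegral_lintegral_swap (by fun_prop),
    ← lintegral_exp_mul_sq_gaussianReal (a := l * c) (by linarith)]
  refine lintegral_mono fun g => ?_
  rw [← ofReal_integral_eq_lintegral_ofReal (h.integrable_exp_mul _)
      (ae_of_all _ fun x => by positivity)]
  refine ENNReal.ofReal_le_ofReal ((h.mgf_le _).trans_eq ?_)
  rw [mul_pow, Real.sq_sqrt (by positivity)]
  congr 1
  ring

/-- Exponential moment of the squared deviation between the mean and the empirical mean of a
`[0, 1]`-valued function on an i.i.d. sample. -/
lemma lintegral_exp_sq_mean_sub_empiricalMean_le {Z ι : Type*} [MeasurableSpace Z] [Fintype ι]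
    [Nonempty ι] (𝒟 : Measure Z) [IsProbabilityMeasure 𝒟] {f : Z → ℝ} (hf : Measurable f)
    (hf' : ∀ z, f z ∈ Set.Icc (0 : ℝ) 1) :
    ∫⁻ s, ENNReal.ofReal (Real.exp ((2 * (Fintype.card ι : ℝ) - 1)
        * (∫ z, f z ∂𝒟 - (Fintype.card ι : ℝ)⁻¹ * ∑ i, f (s i)) ^ 2))
        ∂(Measure.pi fun _ : ι => 𝒟)
      ≤ ENNReal.ofReal (√(2 * (Fintype.card ι : ℝ))) := by
  set M : ℝ := (Fintype.card ι : ℝ) with hM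
  have hM1 : 1 ≤ M := by rw [hM]; exact_mod_cast Fintype.card_pos
  have hsub : ∀ i : ι, HasSubgaussianMGF (fun s : ι → Z => f (s i) - ∫ z, f z ∂𝒟)
      ((‖(1 : ℝ) - 0‖₊ / 2) ^ 2) (Measure.pi fun _ : ι => 𝒟) := by
    intro i
    have h := hasSubgaussianMGF_of_mem_Icc (μ := 𝒟) hf.aemeasurable (ae_of_all _ hf')
    refine HasSubgaussianMGF.of_map (X := fun z => f z - ∫ z, f z ∂𝒟)
      (Y := fun s : ι → Z => s i) (measurable_pi_apply i).aemeasurable ?_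
    rwa [(measurePreserving_eval (fun _ : ι => 𝒟) i).map_eq]
  have hind : iIndepFun (fun (i : ι) (s : ι → Z) => f (s i) - ∫ z, f z ∂𝒟)
      (Measure.pi fun _ : ι => 𝒟) :=
    iIndepFun_pi (X := fun _ z => f z - ∫ z, f z ∂𝒟) fun i => by fun_prop
  have hs := (HasSubgaussianMGF.sum_of_iIndepFun hind
    (s := Finset.univ) (fun i _ => hsub i)).const_mul (-M⁻¹)
  have hX : ∀ s : ι → Z, -M⁻¹ * ∑ i, (f (s i) - ∫ z, f z ∂𝒟)
      = ∫ z, f z ∂𝒟 - M⁻¹ * ∑ i, f (s i) := by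
    intro s
    rw [Finset.sum_sub_distrib, Finset.sum_const, Finset.card_univ, nsmul_eq_mul, ← hM]
    field_simp
    ring
  simp_rw [hX] at hs
  -- The sum of `M` terms with proxy `(1/2)²`, scaled by `-M⁻¹`, has proxy `M⁻² · M/4`.
  obtain ⟨c, hc, hs⟩ : ∃ c : ℝ≥0, (c : ℝ) = 1 / (4 * M) ∧ HasSubgaussianMGF
      (fun s : ι → Z => ∫ z, f z ∂𝒟 - M⁻¹ * ∑ i, f (s i)) c (Measure.pi fun _ : ι => 𝒟) := by
    refine ⟨_, ?_, hs⟩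
    change (-M⁻¹) ^ 2 * ((∑ _i : ι, (‖(1 : ℝ) - 0‖₊ / 2) ^ 2 : ℝ≥0) : ℝ) = _
    simp [← hM]
    field_simp
    norm_num
  -- Here `2lc = 1 - 1/(2M)`, just below the critical value `1`, whence the bound `√(2M)`.
  refine (hs.lintegral_exp_mul_sq_le (by fun_prop) (l := 2 * M - 1) (by linarith) ?_).trans_eq ?_
  · rw [hc]
    field_simp
    linarith
  · rw [hc]
    congr 2
    field_simp
    ring

/-! ### Gaussian change of measure and Donsker–Varadhan. -/

/-- Both sides have the same characteristic function. The explicit density lets the Lebesgue change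
of variables act on Gaussian integrals. -/
lemma stdGaussian_eq_withDensity (d : ℕ) :
    stdGaussian (EuclideanSpace ℝ (Fin d)) = volume.withDensity fun x =>
      ENNReal.ofReal (((2 * Real.pi) ^ ((d : ℝ) / 2))⁻¹ * Real.exp (-(1 / 2) * ‖x‖ ^ 2)) := by
  have hint : Integrable (fun x : EuclideanSpace ℝ (Fin d) =>
      ((2 * Real.pi) ^ ((d : ℝ) / 2))⁻¹ * Real.exp (-(1 / 2) * ‖x‖ ^ 2)) := by
    refine Integrable.const_mul ?_ _
    have := (GaussianFourier.integrable_cexp_neg_mul_sq_norm_add (V := EuclideanSpace ℝ (Fin d))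
      (b := (1 / 2 : ℝ)) (by norm_num) 0 0).re
    refine this.congr (ae_of_all _ fun x => ?_)
    simp only [zero_mul, add_zero, RCLike.re_eq_complex_re]
    rw [← Complex.exp_ofReal_re]
    push_cast
    rfl
  have : IsFiniteMeasure ((volume : Measure (EuclideanSpace ℝ (Fin d))).withDensity fun x =>
      ENNReal.ofReal (((2 * Real.pi) ^ ((d : ℝ) / 2))⁻¹ * Real.exp (-(1 / 2) * ‖x‖ ^ 2))) :=
    isFiniteMeasure_withDensity_ofReal hint.2
  refine Measure.ext_of_charFun (funext fun t => ?_)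
  rw [charFun_stdGaussian, charFun_apply, integral_withDensity_eq_integral_toReal_smul
    (by fun_prop) (ae_of_all _ fun _ => ENNReal.ofReal_lt_top)]
  have h := GaussianFourier.integral_cexp_neg_mul_sq_norm_add (V := EuclideanSpace ℝ (Fin d))
      (b := (1 / 2 : ℝ)) (by norm_num) Complex.I t
  have e : ∀ x : EuclideanSpace ℝ (Fin d),
      (ENNReal.ofReal (((2 * Real.pi) ^ ((d : ℝ) / 2))⁻¹ * Real.exp (-(1 / 2) * ‖x‖ ^ 2))).toReal
        • Complex.exp (⟪x, t⟫ * Complex.I)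
      = ((((2 * Real.pi) ^ ((d : ℝ) / 2))⁻¹ : ℝ) : ℂ)
        * Complex.exp (-((1 / 2 : ℝ) : ℂ) * ‖x‖ ^ 2 + Complex.I * ⟪t, x⟫) := by
    intro x
    rw [ENNReal.toReal_ofReal (by positivity), Complex.real_smul, Complex.ofReal_mul, mul_assoc,
      Complex.exp_add, Complex.ofReal_exp, real_inner_comm, mul_comm Complex.I]
    push_cast
    rfl
  simp_rw [e]
  rw [integral_const_mul, h, finrank_euclideanSpace_fin]
  have hpi : ((Real.pi : ℂ) / ((1 / 2 : ℝ) : ℂ)) ^ ((d : ℂ) / 2)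
      = (((2 * Real.pi) ^ ((d : ℝ) / 2) : ℝ) : ℂ) := by
    rw [Complex.ofReal_cpow (by positivity)]
    push_cast
    congr 1
    field_simp
  rw [hpi, ← mul_assoc, ← Complex.ofReal_mul, inv_mul_cancel₀ (by positivity)]
  simp only [Complex.ofReal_one, one_mul, Complex.I_sq]
  congr 1
  push_cast
  ring

/-- Change of variables for the standard Gaussian measure under an invertible linear map. -/
lemma lintegral_stdGaussian_comp_linear {d : ℕ}
    (L : EuclideanSpace ℝ (Fin d) →L[ℝ] EuclideanSpace ℝ (Fin d))
    (hL : LinearMap.det (L : EuclideanSpace ℝ (Fin d) →ₗ[ℝ] EuclideanSpace ℝ (Fin d)) ≠ 0)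
    {h : EuclideanSpace ℝ (Fin d) → ℝ} (hh : Measurable h) :
    ∫⁻ x, ENNReal.ofReal (Real.exp (h x)) ∂stdGaussian (EuclideanSpace ℝ (Fin d))
      = ∫⁻ x, ENNReal.ofReal (Real.exp (h (L x)
          + Real.log |LinearMap.det (L : EuclideanSpace ℝ (Fin d) →ₗ[ℝ] EuclideanSpace ℝ (Fin d))|
          + (‖x‖ ^ 2 - ‖L x‖ ^ 2) / 2)) ∂stdGaussian (EuclideanSpace ℝ (Fin d)) := by
  set D := LinearMap.det (L : EuclideanSpace ℝ (Fin d) →ₗ[ℝ] EuclideanSpace ℝ (Fin d)) with hD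
  have hD' : 0 < |D| := abs_pos.2 hL
  set c := ((2 * Real.pi) ^ ((d : ℝ) / 2))⁻¹ with hc
  have hmap := Measure.map_linearMap_addHaar_eq_smul_addHaar
    (volume : Measure (EuclideanSpace ℝ (Fin d))) hL
  have hvol : (volume : Measure (EuclideanSpace ℝ (Fin d)))
      = ENNReal.ofReal |D| • Measure.map L volume := by
    have : Measure.map L (volume : Measure (EuclideanSpace ℝ (Fin d)))
      = ENNReal.ofReal |D⁻¹| • volume := hmap
    rw [this, smul_smul, ← ENNReal.ofReal_mul hD'.le, abs_inv, mul_inv_cancel₀ hD'.ne',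
      ENNReal.ofReal_one, one_smul]
  rw [stdGaussian_eq_withDensity, lintegral_withDensity_eq_lintegral_mul _ (by fun_prop)
    (by fun_prop), lintegral_withDensity_eq_lintegral_mul _ (by fun_prop) (by fun_prop)]
  conv_lhs => rw [hvol]
  rw [lintegral_smul_measure, lintegral_map (by fun_prop) (by fun_prop), smul_eq_mul,
    ← lintegral_const_mul _ (by fun_prop)]
  refine lintegral_congr fun x => ?_
  simp only [Pi.mul_apply]
  rw [← ENNReal.ofReal_mul (by positivity), ← ENNReal.ofReal_mul (by positivity),
    ← ENNReal.ofReal_mul (by positivity)]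
  congr 1
  conv_lhs => rw [← Real.exp_log hD']
  rw [mul_assoc, mul_assoc, mul_left_comm, ← Real.exp_add, ← Real.exp_add, ← Real.exp_add]
  congr 2
  ring

/-- `√V` pushes the standard Gaussian to `N(0, V)`, whose coordinate variances are the diagonal of
`V`. This supplies the trace term of the divergence. -/
lemma integral_norm_sq_toEuclideanCLM_sqrt_stdGaussian {d : ℕ} {V : Matrix (Fin d) (Fin d) ℝ}
    (hV : V.PosSemidef) :
    Integrable (fun x => ‖Matrix.toEuclideanCLM (𝕜 := ℝ) (CFC.sqrt V) x‖ ^ 2)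
        (stdGaussian (EuclideanSpace ℝ (Fin d))) ∧
      ∫ x, ‖Matrix.toEuclideanCLM (𝕜 := ℝ) (CFC.sqrt V) x‖ ^ 2
        ∂stdGaussian (EuclideanSpace ℝ (Fin d)) = V.trace := by
  have hmeas : Measurable fun x : EuclideanSpace ℝ (Fin d) =>
      0 + Matrix.toEuclideanCLM (𝕜 := ℝ) (CFC.sqrt V) x := by fun_prop
  have hsq : ∀ i : Fin d, Integrable (fun y : EuclideanSpace ℝ (Fin d) => y i ^ 2)
      (multivariateGaussian 0 V) := fun i => by
    have h : MemLp (fun y : EuclideanSpace ℝ (Fin d) => y i) 2 (multivariateGaussian 0 V) := by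
      rw [show (fun y : EuclideanSpace ℝ (Fin d) => y i)
        = EuclideanSpace.proj (𝕜 := ℝ) i ∘ id from rfl]
      exact IsGaussian.memLp_two_id.continuousLinearMap_comp _
    exact h.integrable_sq
  have hval : ∀ i : Fin d, ∫ y : EuclideanSpace ℝ (Fin d), y i ^ 2 ∂multivariateGaussian 0 V
      = V i i := fun i => by
    rw [← variance_eval_multivariateGaussian (μ := 0) hV i, variance_of_integral_eq_zero]
    · exact Measurable.aemeasurable (by fun_prop)
    · have h := (EuclideanSpace.proj (𝕜 := ℝ) i).integral_comp_comm
        (IsGaussian.integrable_id (μ := multivariateGaussian (0 : EuclideanSpace ℝ (Fin d)) V))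
      simp only [id, integral_id_multivariateGaussian, map_zero] at h
      exact h
  have hint : Integrable (fun y : EuclideanSpace ℝ (Fin d) => ‖y‖ ^ 2)
      (multivariateGaussian 0 V) := by
    simp_rw [EuclideanSpace.real_norm_sq_eq]
    exact integrable_finsetSum _ fun i _ => hsq i
  constructor
  · rw [multivariateGaussian, integrable_map_measure (by fun_prop) hmeas.aemeasurable] at hint
    simpa [Function.comp_def] using hint
  · have h : ∫ y : EuclideanSpace ℝ (Fin d), ‖y‖ ^ 2 ∂multivariateGaussian 0 V = V.trace := by
      simp_rw [EuclideanSpace.real_norm_sq_eq]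
      rw [integral_finsetSum _ fun i _ => hsq i]
      simp [hval, Matrix.trace]
    rw [multivariateGaussian, integral_map hmeas.aemeasurable (by fun_prop)] at h
    simpa using h

/-- The Donsker–Varadhan inequality for `multivariateGaussian c V` relative to
`multivariateGaussian c 1`, with the Kullback–Leibler divergence written out. -/
lemma integral_multivariateGaussian_le_log_add {d : ℕ} {V : Matrix (Fin d) (Fin d) ℝ}
    (hV : V.PosSemidef) (hdet : V.det ≠ 0) (c : EuclideanSpace ℝ (Fin d))
    {g : EuclideanSpace ℝ (Fin d) → ℝ} (hg : Measurable g) {K : ℝ} (hK : ∀ x, |g x| ≤ K)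
    {M : ℝ} (hM : 0 < M)
    (hgM : ∫⁻ x, ENNReal.ofReal (Real.exp (g x)) ∂multivariateGaussian c 1 ≤ ENNReal.ofReal M) :
    ∫ x, g x ∂multivariateGaussian c V
      ≤ Real.log M + (V.trace - d - Real.log V.det) / 2 := by
  set L := Matrix.toEuclideanCLM (𝕜 := ℝ) (CFC.sqrt V) with hL
  have hLdet : LinearMap.det (L : EuclideanSpace ℝ (Fin d) →ₗ[ℝ] EuclideanSpace ℝ (Fin d))
      = (CFC.sqrt V).det := by
    rw [hL, Matrix.coe_toEuclideanCLM_eq_toEuclideanLin]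
    exact LinearMap.det_toLpLin 2 _
  have hsq : (CFC.sqrt V).det * (CFC.sqrt V).det = V.det := by
    rw [← Matrix.det_mul, CFC.sqrt_mul_sqrt_self _ hV.nonneg]
  have hne : (CFC.sqrt V).det ≠ 0 := fun h => hdet (by rw [← hsq, h, zero_mul])
  have hlog : Real.log |(CFC.sqrt V).det| = Real.log V.det / 2 := by
    rw [Real.log_abs, ← hsq, Real.log_mul hne hne]
    ring
  obtain ⟨hi1, he1⟩ := integral_norm_sq_toEuclideanCLM_sqrt_stdGaussian hV
  obtain ⟨hi0, he0⟩ := integral_norm_sq_toEuclideanCLM_sqrt_stdGaussian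
    (Matrix.PosSemidef.one (n := Fin d) (R := ℝ))
  simp only [CFC.sqrt_one, map_one, one_apply_eq_self, Matrix.trace_one,
    Fintype.card_fin] at hi0 he0
  rw [multivariateGaussian, lintegral_map (by fun_prop) (by fun_prop)] at hgM
  simp only [CFC.sqrt_one, map_one, one_apply_eq_self] at hgM
  rw [lintegral_stdGaussian_comp_linear L (by rwa [hLdet]) (h := fun x => g (c + x))
    (by fun_prop), hLdet, hlog] at hgM
  rw [multivariateGaussian, integral_map (Measurable.aemeasurable (by fun_prop))
    (Measurable.aestronglyMeasurable (by fun_prop)), ← hL]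
  have hLm : Measurable L := L.continuous.measurable
  have hgi : Integrable (fun x => g (c + L x)) (stdGaussian (EuclideanSpace ℝ (Fin d))) :=
    Integrable.of_bound (Measurable.aestronglyMeasurable (by fun_prop)) K (ae_of_all _ fun x => hK _)
  -- `Y` is `g` minus the log-likelihood ratio of posterior to prior, pulled back to the standard
  -- Gaussian. Its mean is the posterior mean of `g` minus the divergence, so Jensen for `exp` is
  -- Donsker–Varadhan.
  set Y : EuclideanSpace ℝ (Fin d) → ℝ := fun x =>
    g (c + L x) + Real.log V.det / 2 + (‖x‖ ^ 2 - ‖L x‖ ^ 2) / 2 with hY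
  rw [← hL] at hi1 he1
  have h1 : Integrable (fun x => g (c + L x) + Real.log V.det / 2)
      (stdGaussian (EuclideanSpace ℝ (Fin d))) := hgi.add (integrable_const _)
  have h2 : Integrable (fun x => (‖x‖ ^ 2 - ‖L x‖ ^ 2) / 2)
      (stdGaussian (EuclideanSpace ℝ (Fin d))) := (hi0.sub hi1).div_const 2
  have hYi : Integrable Y (stdGaussian (EuclideanSpace ℝ (Fin d))) := h1.add h2
  have hYe : ∫ x, Y x ∂stdGaussian (EuclideanSpace ℝ (Fin d))
      = ∫ x, g (c + L x) ∂stdGaussian (EuclideanSpace ℝ (Fin d)) + Real.log V.det / 2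
        + (d - V.trace) / 2 := by
    rw [hY, integral_add h1 h2, integral_add hgi (integrable_const _), integral_div, integral_div,
      integral_sub hi0 hi1, he0, he1]
    simp
  have hexpi : Integrable (fun x => Real.exp (Y x)) (stdGaussian (EuclideanSpace ℝ (Fin d))) := by
    refine ⟨Measurable.aestronglyMeasurable (by fun_prop), ?_⟩
    rw [hasFiniteIntegral_iff_ofReal (ae_of_all _ fun x => by positivity)]
    exact hgM.trans_lt ENNReal.ofReal_lt_top
  have hexp : ∫ x, Real.exp (Y x) ∂stdGaussian (EuclideanSpace ℝ (Fin d)) ≤ M := by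
    rw [integral_eq_lintegral_of_nonneg_ae (ae_of_all _ fun x => by positivity) (by fun_prop)]
    exact ENNReal.toReal_le_of_le_ofReal hM.le hgM
  have hjensen := convexOn_exp.map_integral_le (μ := stdGaussian (EuclideanSpace ℝ (Fin d)))
    (f := Y) Real.continuous_exp.continuousOn isClosed_univ (by simp) hYi hexpi
  have := (Real.le_log_iff_exp_le hM).2 (hjensen.trans hexp)
  rw [hYe] at this
  linarith

/-! ### Stationary law of the Ornstein–Uhlenbeck process. -/

section OrnsteinUhlenbeck

attribute [local instance] Matrix.linftyOpNormedRing Matrix.linftyOpNormedAlgebra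

variable {d : ℕ}

lemma Matrix.PosDef.exists_orthogonal_diagonalization {Γ : Matrix (Fin d) (Fin d) ℝ}
    (hΓ : Γ.PosDef) : ∃ (U : Matrix (Fin d) (Fin d) ℝ) (γ : Fin d → ℝ), U * Uᵀ = 1 ∧ Uᵀ * U = 1 ∧
      Γ = U * Matrix.diagonal γ * Uᵀ ∧ ∀ i, 0 < γ i := by
  refine ⟨hΓ.1.eigenvectorUnitary, hΓ.1.eigenvalues, ?_, ?_, ?_, hΓ.eigenvalues_pos⟩
  · exact Unitary.coe_mul_star_self hΓ.1.eigenvectorUnitary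
  · exact Unitary.coe_star_mul_self hΓ.1.eigenvectorUnitary
  · exact hΓ.1.spectral_theorem

lemma tendsto_exp_neg_smul_atTop {Γ : Matrix (Fin d) (Fin d) ℝ} (hΓ : Γ.PosDef) :
    Tendsto (fun t : ℝ => NormedSpace.exp (-t • Γ)) atTop (𝓝 0) := by
  obtain ⟨U, γ, h1, h2, h3, hγ⟩ := hΓ.exists_orthogonal_diagonalization
  have hU : U⁻¹ = Uᵀ := Matrix.inv_eq_right_inv h1
  have he : ∀ t : ℝ, NormedSpace.exp (-t • Γ)
      = U * Matrix.diagonal (fun i => Real.exp (-t * γ i)) * Uᵀ := by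
    intro t
    have : -t • Γ = U * Matrix.diagonal (fun i => -t * γ i) * U⁻¹ := by
      rw [h3, hU, ← Matrix.smul_mul, ← Matrix.mul_smul, ← Matrix.diagonal_smul]
      rfl
    rw [this, Matrix.exp_conj _ _ (IsUnit.of_mul_eq_one _ h1), Matrix.exp_diagonal, hU]
    congr 3
    funext i
    rw [Pi.coe_exp, Real.exp_eq_exp_ℝ]
  simp_rw [he]
  have hd : Tendsto (fun t : ℝ => Matrix.diagonal (fun i => Real.exp (-t * γ i))) atTop
      (𝓝 (Matrix.diagonal (0 : Fin d → ℝ))) := by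
    refine ((continuous_id.matrix_diagonal).tendsto _).comp (tendsto_pi_nhds.2 fun i => ?_)
    refine Real.tendsto_exp_atBot.comp ?_
    simp_rw [neg_mul]
    exact tendsto_neg_atTop_atBot.comp (tendsto_id.atTop_mul_const (hγ i))
  have := (hd.const_mul U).mul_const Uᵀ
  simpa using this

lemma exists_lyapunov_solution {Γ : Matrix (Fin d) (Fin d) ℝ} (hΓ : Γ.PosDef)
    (D : Matrix (Fin d) (Fin d) ℝ) : ∃ V, Γ * V + V * Γ = D := by
  obtain ⟨U, γ, h1, h2, h3, hγ⟩ := hΓ.exists_orthogonal_diagonalization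
  -- In an eigenbasis of `Γ` the Lyapunov equation decouples into `(γ i + γ j) X i j = D' i j` with
  -- `D' = Uᵀ D U`.
  set X : Matrix (Fin d) (Fin d) ℝ := Matrix.of fun i j => (Uᵀ * D * U) i j / (γ i + γ j) with hX
  have hXD : Matrix.diagonal γ * X + X * Matrix.diagonal γ = Uᵀ * D * U := by
    ext i j
    have := (add_pos (hγ i) (hγ j)).ne'
    simp only [Matrix.add_apply, Matrix.diagonal_mul, Matrix.mul_diagonal, hX, Matrix.of_apply]
    field_simp
  refine ⟨U * X * Uᵀ, ?_⟩
  calc Γ * (U * X * Uᵀ) + U * X * Uᵀ * Γ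
      = U * Matrix.diagonal γ * (Uᵀ * U) * X * Uᵀ
        + U * X * (Uᵀ * U) * Matrix.diagonal γ * Uᵀ := by rw [h3]; simp only [Matrix.mul_assoc]
    _ = U * (Matrix.diagonal γ * X + X * Matrix.diagonal γ) * Uᵀ := by
        rw [h2]; simp only [Matrix.mul_add, Matrix.add_mul, Matrix.mul_assoc, Matrix.one_mul]
    _ = (U * Uᵀ) * D * (U * Uᵀ) := by rw [hXD]; simp only [Matrix.mul_assoc]
    _ = D := by rw [h1, Matrix.one_mul, Matrix.mul_one]

lemma continuous_exp_neg_sub_smul (Γ : Matrix (Fin d) (Fin d) ℝ) (t : ℝ) :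
    Continuous fun s : ℝ => NormedSpace.exp (-(t - s) • Γ) :=
  NormedSpace.exp_continuous.comp (by fun_prop)

/-- The noise covariance of an Ornstein–Uhlenbeck process, tested against a linear functional. -/
lemma integral_linear_exp_mul_mul_exp {Γ V D : Matrix (Fin d) (Fin d) ℝ}
    (hVD : Γ * V + V * Γ = D) (φ : Matrix (Fin d) (Fin d) ℝ →ₗ[ℝ] ℝ) (t : ℝ) :
    ∫ s in (0 : ℝ)..t, φ (NormedSpace.exp (-(t - s) • Γ) * D * NormedSpace.exp (-(t - s) • Γ))
      = φ V - φ (NormedSpace.exp (-t • Γ) * V * NormedSpace.exp (-t • Γ)) := by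
  have hc : Continuous φ := φ.continuous_of_finiteDimensional
  have hE := continuous_exp_neg_sub_smul Γ t
  have hderiv : ∀ s : ℝ, HasDerivAt
      (fun s => φ (NormedSpace.exp (-(t - s) • Γ) * V * NormedSpace.exp (-(t - s) • Γ)))
      (φ (NormedSpace.exp (-(t - s) • Γ) * D * NormedSpace.exp (-(t - s) • Γ))) s := by
    intro s
    have h0 : HasDerivAt (fun s : ℝ => -(t - s)) 1 s := by
      simpa only [neg_sub] using (hasDerivAt_id' s).sub_const t
    -- The derivative of the left exponential is written with `Γ` on its right, that of the right
    -- one with `Γ` on its left, so that `ΓV + VΓ` appears between the exponentials.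
    have h1 := (hasDerivAt_exp_smul_const (𝕂 := ℝ) Γ (-(t - s))).scomp s h0
    have h2 := (hasDerivAt_exp_smul_const' (𝕂 := ℝ) Γ (-(t - s))).scomp s h0
    have h3 := (h1.mul_const V).mul h2
    have h4 := (LinearMap.toContinuousLinearMap φ).hasFDerivAt.comp_hasDerivAt s h3
    refine h4.congr_deriv ?_
    change φ _ = φ _
    congr 1
    simp only [one_smul, Function.comp_apply]
    rw [← hVD]
    noncomm_ring
  rw [intervalIntegral.integral_eq_sub_of_hasDerivAt (fun s _ => hderiv s)
    (Continuous.intervalIntegrable (by fun_prop) _ _)]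
  simp

lemma transpose_exp_smul_of_isSymm {Γ : Matrix (Fin d) (Fin d) ℝ} (hΓ : Γᵀ = Γ) (u : ℝ) :
    (NormedSpace.exp (u • Γ))ᵀ = NormedSpace.exp (u • Γ) := by
  rw [← Matrix.exp_transpose, Matrix.transpose_smul, hΓ]

lemma ouCovariance_eq_sub {Γ σ V : Matrix (Fin d) (Fin d) ℝ} (hΓ : Γᵀ = Γ)
    (hV : Γ * V + V * Γ = σ * σᵀ) (t : ℝ) :
    ouCovariance Γ σ t = V - NormedSpace.exp (-t • Γ) * V * NormedSpace.exp (-t • Γ) := by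
  ext i j
  have := integral_linear_exp_mul_mul_exp hV (Matrix.entryLinearMap ℝ ℝ i j) t
  simp only [Matrix.entryLinearMap_apply] at this
  simp only [ouCovariance, Matrix.of_apply, transpose_exp_smul_of_isSymm hΓ, Matrix.sub_apply]
  exact this

/-- Each quadratic form of the covariance is the integral of a nonnegative function. -/
lemma ouCovariance_posSemidef {Γ σ V : Matrix (Fin d) (Fin d) ℝ} (hΓ : Γᵀ = Γ)
    (hV : Γ * V + V * Γ = σ * σᵀ) {t : ℝ} (ht : 0 ≤ t) :
    (ouCovariance Γ σ t).PosSemidef := by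
  have hpsd : ∀ s : ℝ, (NormedSpace.exp (-(t - s) • Γ) * (σ * σᵀ)
      * (NormedSpace.exp (-(t - s) • Γ))ᵀ).PosSemidef := fun s =>
    (Matrix.posSemidef_self_mul_conjTranspose σ).mul_mul_conjTranspose_same _
  refine Matrix.PosSemidef.of_dotProduct_mulVec_nonneg ?_ fun x => ?_
  · ext i j
    simp only [Matrix.conjTranspose_apply, star_trivial, ouCovariance, Matrix.of_apply]
    refine intervalIntegral.integral_congr fun s _ => ?_
    simpa using congrFun (congrFun (hpsd s).1 i) j
  · let φ : Matrix (Fin d) (Fin d) ℝ →ₗ[ℝ] ℝ :=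
      { toFun := fun W => x ⬝ᵥ W *ᵥ x
        map_add' := fun W W' => by rw [Matrix.add_mulVec, dotProduct_add]
        map_smul' := fun a W => by rw [Matrix.smul_mulVec, dotProduct_smul]; rfl }
    have h := integral_linear_exp_mul_mul_exp hV φ t
    rw [← map_sub, ← ouCovariance_eq_sub hΓ hV] at h
    change 0 ≤ φ (ouCovariance Γ σ t)
    rw [← h]
    refine intervalIntegral.integral_nonneg ht fun s _ => ?_
    have := (hpsd s).dotProduct_mulVec_nonneg x
    rw [transpose_exp_smul_of_isSymm hΓ] at this
    exact this

lemma tendsto_ouCovariance_atTop {Γ σ V : Matrix (Fin d) (Fin d) ℝ} (hΓ : Γ.PosDef)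
    (hV : Γ * V + V * Γ = σ * σᵀ) :
    Tendsto (ouCovariance Γ σ) atTop (𝓝 V) := by
  have hsymm : Γᵀ = Γ := hΓ.1
  have hE := tendsto_exp_neg_smul_atTop hΓ
  have := (tendsto_const_nhds (x := V)).sub ((hE.mul_const V).mul hE)
  rw [Matrix.zero_mul, Matrix.zero_mul, sub_zero] at this
  exact this.congr fun t => (ouCovariance_eq_sub hsymm hV t).symm

lemma Matrix.PosSemidef.of_tendsto {α : Type*} {l : Filter α} [l.NeBot]
    {f : α → Matrix (Fin d) (Fin d) ℝ} {V : Matrix (Fin d) (Fin d) ℝ} (hf : Tendsto f l (𝓝 V))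
    (h : ∀ᶠ a in l, (f a).PosSemidef) : V.PosSemidef := by
  refine Matrix.PosSemidef.of_dotProduct_mulVec_nonneg ?_ fun x => ?_
  · exact (isClosed_eq (f := fun W : Matrix (Fin d) (Fin d) ℝ => Wᴴ) (by fun_prop)
      continuous_id).mem_of_tendsto hf (h.mono fun a ha => ha.1)
  · exact (isClosed_le (f := fun _ => (0 : ℝ))
      (g := fun W : Matrix (Fin d) (Fin d) ℝ => star x ⬝ᵥ W *ᵥ x) continuous_const
      (by fun_prop)).mem_of_tendsto hf (h.mono fun a ha => ha.dotProduct_mulVec_nonneg x)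

/-- The stationary distribution of an Ornstein–Uhlenbeck process with positive definite drift
matrix is Gaussian, and its covariance matrix solves the Lyapunov equation. -/
theorem IsOUStationary.exists_eq_multivariateGaussian {c : EuclideanSpace ℝ (Fin d)}
    {Γ σ : Matrix (Fin d) (Fin d) ℝ} {Q : Measure (EuclideanSpace ℝ (Fin d))} (hΓ : Γ.PosDef)
    (hQ : IsOUStationary c Γ σ Q) :
    ∃ V : Matrix (Fin d) (Fin d) ℝ, V.PosSemidef ∧ Γ * V + V * Γ = σ * σᵀ ∧
      Q = multivariateGaussian c V := by
  have hsymm : Γᵀ = Γ := hΓ.1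
  have := hQ.isProbabilityMeasure
  obtain ⟨V, hV⟩ := exists_lyapunov_solution hΓ (σ * σᵀ)
  have hlim := tendsto_ouCovariance_atTop hΓ hV
  have hpsd : V.PosSemidef := .of_tendsto hlim
    ((eventually_ge_atTop 0).mono fun t ht => ouCovariance_posSemidef hsymm hV ht)
  refine ⟨V, hpsd, hV, Measure.ext_of_charFun (funext fun u => ?_)⟩
  have hE := tendsto_exp_neg_smul_atTop hΓ
  set a : ℝ → EuclideanSpace ℝ (Fin d) → EuclideanSpace ℝ (Fin d) := fun t x =>
    c + Matrix.toEuclideanCLM (𝕜 := ℝ) (NormedSpace.exp (-t • Γ)) (x - c) with ha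
  have ham : ∀ t, Measurable (a t) := fun t => by fun_prop
  -- The drift forgets the initial law: `a t x` tends to `c` for every `x`, and dominated
  -- convergence needs no moments of `Q`.
  have hmean : Tendsto (fun t => charFun (Q.map (a t)) u) atTop
      (𝓝 (Complex.exp (⟪u, c⟫ * Complex.I))) := by
    have h1 : Tendsto (fun t => ∫ x, Complex.exp (⟪a t x, u⟫ * Complex.I) ∂Q) atTop
        (𝓝 (∫ x, Complex.exp (⟪c, u⟫ * Complex.I) ∂Q)) := by
      refine tendsto_integral_filter_of_dominated_convergence (fun _ => 1)
        (Eventually.of_forall fun t => Measurable.aestronglyMeasurable (by fun_prop))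
        (Eventually.of_forall fun t => ae_of_all _ fun x => ?_) (integrable_const _)
        (ae_of_all _ fun x => ?_)
      · rw [Complex.norm_exp_ofReal_mul_I]
      · have hlin : Tendsto (fun t => a t x) atTop (𝓝 c) := by
          have hcont : Continuous fun W : Matrix (Fin d) (Fin d) ℝ =>
              c + Matrix.toEuclideanCLM (𝕜 := ℝ) W (x - c) := by
            refine continuous_const.add ?_
            exact (PiLp.continuous_toLp 2 _).comp
              (by fun_prop : Continuous fun W : Matrix (Fin d) (Fin d) ℝ => W *ᵥ (x - c).ofLp)
          have := (hcont.tendsto 0).comp hE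
          rw [map_zero, zero_apply, add_zero] at this
          exact this
        have hc : Continuous fun y : EuclideanSpace ℝ (Fin d) =>
            Complex.exp (⟪y, u⟫ * Complex.I) := by fun_prop
        exact (hc.tendsto c).comp hlin
    rw [integral_const, probReal_univ, one_smul, real_inner_comm] at h1
    refine h1.congr fun t => ?_
    rw [charFun_apply, integral_map (ham t).aemeasurable
      (Measurable.aestronglyMeasurable (by fun_prop))]
  have hnoise : Tendsto (fun t => charFun (multivariateGaussian
      (0 : EuclideanSpace ℝ (Fin d)) (ouCovariance Γ σ t)) u) atTop
      (𝓝 (Complex.exp (-(((u ⬝ᵥ V *ᵥ u : ℝ) : ℂ) / 2)))) := by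
    have hc : Continuous fun W : Matrix (Fin d) (Fin d) ℝ =>
        Complex.exp (-(((u ⬝ᵥ W *ᵥ u : ℝ) : ℂ) / 2)) := by fun_prop
    refine ((hc.tendsto V).comp hlim).congr' ?_
    filter_upwards [eventually_ge_atTop 0] with t ht
    rw [charFun_multivariateGaussian (ouCovariance_posSemidef hsymm hV ht)]
    simp
  have hconst : Tendsto (fun _ : ℝ => charFun Q u) atTop (𝓝 (Complex.exp (⟪u, c⟫ * Complex.I)
      * Complex.exp (-(((u ⬝ᵥ V *ᵥ u : ℝ) : ℂ) / 2)))) := by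
    refine (hmean.mul hnoise).congr' ?_
    filter_upwards [eventually_ge_atTop 0] with t ht
    have := Measure.isProbabilityMeasure_map (μ := Q) (ham t).aemeasurable
    rw [← charFun_conv]
    exact congrArg (charFun · u) (hQ.invariant t ht)
  rw [tendsto_nhds_unique tendsto_const_nhds hconst, charFun_multivariateGaussian hpsd,
    ← Complex.exp_add, sub_eq_add_neg]

end OrnsteinUhlenbeck

/-! ### The PAC-Bayes bound and its application to SGD. -/

/-- PAC-Bayes bound for Gaussian posteriors, with prior `multivariateGaussian c 1`. -/
theorem exists_measurableSet_forall_multivariateGaussian_risk_le {d : ℕ} {Z ι : Type*}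
    [MeasurableSpace Z] [Fintype ι] [Nonempty ι] (𝒟 : Measure Z) [IsProbabilityMeasure 𝒟]
    (F : EuclideanSpace ℝ (Fin d) → Z → ℝ) (hF_meas : Measurable (Function.uncurry F))
    (hF : ∀ θ z, F θ z ∈ Set.Icc (0 : ℝ) 1) (c : EuclideanSpace ℝ (Fin d)) {δ : ℝ} (hδ : 0 < δ) :
    ∃ G : Set (ι → Z), MeasurableSet G ∧ (Measure.pi fun _ => 𝒟) Gᶜ ≤ ENNReal.ofReal δ ∧
      ∀ s ∈ G, ∀ V : Matrix (Fin d) (Fin d) ℝ, V.PosSemidef → V.det ≠ 0 →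
        expectedRisk F 𝒟 (multivariateGaussian c V)
          - empiricalRisk F s (multivariateGaussian c V)
          ≤ √((V.trace - Real.log V.det - d + 2 * Real.log (1 / δ)
              + 2 * Real.log (Fintype.card ι) + 4) / (4 * (Fintype.card ι : ℝ) - 2)) := by
  set M : ℝ := (Fintype.card ι : ℝ) with hMdef
  have hM : 1 ≤ M := by rw [hMdef]; exact_mod_cast Fintype.card_pos
  have hM0 : 0 < M := by linarith
  have hmean : Measurable fun θ => ∫ z, F θ z ∂𝒟 :=
    (hF_meas.stronglyMeasurable.integral_prod_right (ν := 𝒟)).measurable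
  set Δ : (ι → Z) → EuclideanSpace ℝ (Fin d) → ℝ := fun s θ =>
    ∫ z, F θ z ∂𝒟 - M⁻¹ * ∑ i, F θ (s i) with hΔ
  have hFm : ∀ i, Measurable fun p : (ι → Z) × EuclideanSpace ℝ (Fin d) => F p.2 (p.1 i) :=
    fun i => hF_meas.comp (measurable_snd.prodMk ((measurable_pi_apply i).comp measurable_fst))
  have hΔm : Measurable (Function.uncurry Δ) :=
    (hmean.comp measurable_snd).sub
      ((Finset.measurable_sum _ fun i _ => hFm i).const_mul _)
  have hE : ∀ θ, ∫ z, F θ z ∂𝒟 ∈ Set.Icc (0 : ℝ) 1 := fun θ => by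
    refine ⟨integral_nonneg fun z => (hF θ z).1, ?_⟩
    have := integral_mono_of_nonneg (μ := 𝒟) (ae_of_all _ fun z => (hF θ z).1)
      (integrable_const (1 : ℝ)) (ae_of_all _ fun z => (hF θ z).2)
    simpa using this
  have hA : ∀ (s : ι → Z) θ, M⁻¹ * ∑ i, F θ (s i) ∈ Set.Icc (0 : ℝ) 1 := fun s θ => by
    refine ⟨mul_nonneg (by positivity) (Finset.sum_nonneg fun i _ => (hF θ (s i)).1), ?_⟩
    rw [inv_mul_le_one₀ hM0]
    refine (Finset.sum_le_sum fun i _ => (hF θ (s i)).2).trans_eq ?_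
    simp [hMdef]
  have hΔb : ∀ s θ, |Δ s θ| ≤ 1 := fun s θ => by
    have h1 := hE θ
    have h2 := hA s θ
    rw [abs_le]
    constructor
    · linarith [h1.1, h2.2]
    · linarith [h1.2, h2.1]
  set P := multivariateGaussian c (1 : Matrix (Fin d) (Fin d) ℝ) with hP
  set Φ : (ι → Z) → ℝ≥0∞ := fun s =>
    ∫⁻ θ, ENNReal.ofReal (Real.exp ((2 * M - 1) * Δ s θ ^ 2)) ∂P with hΦ
  have hjoint : Measurable fun p : (ι → Z) × EuclideanSpace ℝ (Fin d) =>
      ENNReal.ofReal (Real.exp ((2 * M - 1) * Δ p.1 p.2 ^ 2)) :=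
    (Real.measurable_exp.comp ((hΔm.pow_const 2).const_mul _)).ennreal_ofReal
  have hΦm : Measurable Φ := hjoint.lintegral_prod_right'
  have hΦi : ∫⁻ s, Φ s ∂(Measure.pi fun _ => 𝒟) ≤ ENNReal.ofReal (√(2 * M)) := by
    rw [hΦ, lintegral_lintegral_swap hjoint.aemeasurable]
    calc _ ≤ ∫⁻ _, ENNReal.ofReal (√(2 * M)) ∂P := lintegral_mono fun θ =>
          lintegral_exp_sq_mean_sub_empiricalMean_le 𝒟
            (hF_meas.comp measurable_prodMk_left) (hF θ)
      _ = _ := by simp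
  have hsqrt : 0 < √(2 * M) := by positivity
  -- This event involves only the prior, so the bound holds for all `V` simultaneously; `V` may then
  -- depend on `s` with no measurability.
  refine ⟨{s | Φ s ≤ ENNReal.ofReal (√(2 * M) / δ)}, hΦm measurableSet_Iic, ?_, ?_⟩
  · calc (Measure.pi fun _ => 𝒟) {s | Φ s ≤ ENNReal.ofReal (√(2 * M) / δ)}ᶜ
        ≤ (Measure.pi fun _ => 𝒟) {s | ENNReal.ofReal (√(2 * M) / δ) ≤ Φ s} :=
          measure_mono fun s hs => (not_le.1 (Set.notMem_ofPred_iff.1 hs)).le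
      _ ≤ (∫⁻ s, Φ s ∂(Measure.pi fun _ => 𝒟)) / ENNReal.ofReal (√(2 * M) / δ) :=
          meas_ge_le_lintegral_div hΦm.aemeasurable
            (ENNReal.ofReal_pos.2 (by positivity)).ne' ENNReal.ofReal_ne_top
      _ ≤ ENNReal.ofReal (√(2 * M)) / ENNReal.ofReal (√(2 * M) / δ) := by gcongr
      _ = ENNReal.ofReal δ := by
          rw [← ENNReal.ofReal_div_of_pos (by positivity)]
          congr 1
          field_simp
  · intro s hs V hV hdet
    have hsm : Measurable fun θ => Δ s θ := hΔm.comp measurable_prodMk_left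
    have hbm : Measurable fun θ => M⁻¹ * ∑ i, F θ (s i) :=
      (Finset.measurable_sum _ fun i _ =>
        hF_meas.comp (measurable_id.prodMk measurable_const)).const_mul _
    have hb : ∀ x : EuclideanSpace ℝ (Fin d), |(2 * M - 1) * Δ s x ^ 2| ≤ 2 * M - 1 := fun x => by
      rw [abs_mul, abs_of_pos (by linarith : 0 < 2 * M - 1), abs_pow]
      exact mul_le_of_le_one_right (by linarith) (pow_le_one₀ (abs_nonneg _) (hΔb s x))
    have hDV := integral_multivariateGaussian_le_log_add hV hdet c
      (g := fun θ => (2 * M - 1) * Δ s θ ^ 2) (by fun_prop) hb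
      (M := √(2 * M) / δ) (by positivity) hs
    set Q := multivariateGaussian c V with hQ
    have hi : Integrable (fun θ => Δ s θ) Q :=
      Integrable.of_bound hsm.aestronglyMeasurable 1 (ae_of_all _ fun θ => hΔb s θ)
    have hi2 : Integrable (fun θ => Δ s θ ^ 2) Q := by
      refine Integrable.of_bound (hsm.pow_const 2).aestronglyMeasurable 1
        (ae_of_all _ fun θ => ?_)
      rw [Real.norm_eq_abs, abs_pow]
      exact pow_le_one₀ (abs_nonneg _) (hΔb s θ)
    have hrisk : expectedRisk F 𝒟 Q - empiricalRisk F s Q = ∫ θ, Δ s θ ∂Q := by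
      rw [expectedRisk, empiricalRisk, hΔ, integral_sub]
      · exact Integrable.of_mem_Icc 0 1 hmean.aemeasurable (ae_of_all _ hE)
      · exact Integrable.of_mem_Icc 0 1 hbm.aemeasurable (ae_of_all _ (hA s))
    have hjensen : (∫ θ, Δ s θ ∂Q) ^ 2 ≤ ∫ θ, Δ s θ ^ 2 ∂Q :=
      even_two.convexOn_pow.map_integral_le (continuous_pow 2).continuousOn isClosed_univ
        (by simp) hi hi2
    rw [integral_const_mul, Real.log_div hsqrt.ne' hδ.ne', Real.log_sqrt (by positivity),
      Real.log_mul two_ne_zero hM0.ne'] at hDV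
    -- The argument yields `log M + log 2` where the claim allows `2 log M + 4`; these facts absorb
    -- the difference.
    have hlog2 : Real.log 2 ≤ 1 := by linarith [Real.log_two_lt_d9]
    have hlogM : 0 ≤ Real.log M := Real.log_nonneg hM
    have hlogδ : Real.log (1 / δ) = - Real.log δ := by rw [one_div, Real.log_inv]
    rw [hrisk]
    refine Real.le_sqrt_of_sq_le ?_
    rw [le_div_iff₀ (by linarith), hlogδ]
    have hmul := mul_le_mul_of_nonneg_left hjensen (by linarith : 0 ≤ 2 * M - 1)
    linarith

/-- The stationary distribution of SGD near a minimum at which the Hessian commutes with the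
stationary covariance. -/
theorem IsSGDStationary.exists_eq_multivariateGaussian {d : ℕ} {r η S : ℝ} (hr : 0 < r)
    (hη : 0 < η) (hS : 0 < S) {θstar : EuclideanSpace ℝ (Fin d)}
    {A B C : Matrix (Fin d) (Fin d) ℝ} (hA : A.PosDef) (hC : C = B * Bᵀ)
    {Q : Measure (EuclideanSpace ℝ (Fin d))} (hQ : IsSGDStationary r η S θstar A B Q)
    (hcomm : A * covarianceMatrix Q = covarianceMatrix Q * A) :
    ((r * η / (2 * S)) • (A⁻¹ * C)).PosSemidef ∧
      Q = multivariateGaussian θstar ((r * η / (2 * S)) • (A⁻¹ * C)) := by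
  obtain ⟨V, hV, hL, hQV⟩ := IsOUStationary.exists_eq_multivariateGaussian (hA.smul hr) hQ
  have hcov : covarianceMatrix Q = V := by
    ext i j
    rw [covarianceMatrix, Matrix.of_apply, hQV, covariance_eval_multivariateGaussian hV]
  rw [hcov] at hcomm
  have hdet : IsUnit A.det := hA.det_pos.ne'.isUnit
  have hsq : √(η / S) * √(η / S) = η / S := Real.mul_self_sqrt (by positivity)
  have h1 : (2 * r) • (A * V) = (r ^ 2 * (η / S)) • C := by
    rw [hC, ← hsq]
    rw [Matrix.transpose_smul, Matrix.smul_mul, Matrix.mul_smul, Matrix.smul_mul, Matrix.mul_smul,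
      ← hcomm, smul_smul, ← add_smul] at hL
    rw [two_mul, hL]
    congr 1
    ring
  have h2 : A * V = (r * η / (2 * S)) • C := by
    have := congrArg (fun W => (2 * r)⁻¹ • W) h1
    simp only [smul_smul] at this
    rw [inv_mul_cancel₀ (by positivity), one_smul] at this
    rw [this]
    congr 1
    field_simp
  have h3 : V = (r * η / (2 * S)) • (A⁻¹ * C) := by
    rw [← Matrix.mul_smul, ← h2, ← Matrix.mul_assoc, Matrix.nonsing_inv_mul _ hdet,
      Matrix.one_mul]
  exact h3 ▸ ⟨hV, hQV⟩

theorem mainTheorem7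
    {d n : ℕ} {Z : Type*} [MeasurableSpace Z]
    -- the data distribution
    (𝒟 : Measure Z) [IsProbabilityMeasure 𝒟]
    -- the loss function
    (F : EuclideanSpace ℝ (Fin d) → Z → ℝ)
    (hF_meas : Measurable (Function.uncurry F))
    (hF : ∀ θ z, F θ z ∈ Set.Icc (0 : ℝ) 1)
    -- the sizes of the `n` client datasets and their average `m`
    (N : Fin n → ℕ) (m : ℝ) (hm : m = (∑ i, (N i : ℝ)) / n) (hm_pos : 0 < m)
    -- number of rounds of federated training, learning rate, batch size `k * n * m`
    (T : ℕ) (hT : 0 < T) (η : ℝ) (hη : 0 < η)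
    (k : ℝ) (hk : 1 / (n * m) ≤ k) (hk' : k ≤ 1)
    -- the minimum, the linearized gradient field, and the gradient noise
    (θstar : EuclideanSpace ℝ (Fin d))
    (A B C : TrainingData N Z → Matrix (Fin d) (Fin d) ℝ)
    (hA : ∀ᵐ s ∂(Measure.pi fun _ => 𝒟), (A s).PosDef)
    (hB : ∀ᵐ s ∂(Measure.pi fun _ => 𝒟), C s = B s * (B s).transpose)
    (hC : ∀ᵐ s ∂(Measure.pi fun _ => 𝒟), (C s).PosDef)
    -- the stationary distribution of centralized SGD, run for `T / n` rounds
    (Q : TrainingData N Z → Measure (EuclideanSpace ℝ (Fin d)))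
    (hQ : ∀ᵐ s ∂(Measure.pi fun _ => 𝒟),
      IsSGDStationary ((T : ℝ) / n) η (k * n * m) θstar (A s) (B s) (Q s))
    (hcomm : ∀ᵐ s ∂(Measure.pi fun _ => 𝒟),
      A s * covarianceMatrix (Q s) = covarianceMatrix (Q s) * A s)
    (δ : ℝ) (hδ : 0 < δ) (hδ' : δ < 1) :
    ∃ G : Set (TrainingData N Z), MeasurableSet G ∧
      1 - δ ≤ (Measure.pi fun _ => 𝒟).real G ∧
      ∀ s ∈ G,
        expectedRisk F 𝒟 (Q s) - empiricalRisk F s (Q s) ≤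
          √((((d : ℝ) * Real.log (2 * k * (n : ℝ) ^ 2 * m / (T * η))
                - Real.log (C s * (A s)⁻¹).det)
              + (T : ℝ) * η / (2 * k * (n : ℝ) ^ 2 * m) * (C s * (A s)⁻¹).trace
              - d + 2 * Real.log (1 / δ) + 2 * Real.log (n * m) + 4)
            / (4 * (n : ℝ) * m - 2)) := by
  have hn : (0 : ℝ) < n := by
    rcases Nat.eq_zero_or_pos n with rfl | h
    · simp [hm] at hm_pos
    · exact_mod_cast h
  have hcard : (Fintype.card ((i : Fin n) × Fin (N i)) : ℝ) = n * m := by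
    rw [hm, mul_div_cancel₀ _ hn.ne']
    simp
  have hnm : 0 < n * m := mul_pos hn hm_pos
  have : Nonempty ((i : Fin n) × Fin (N i)) := by
    rw [← Fintype.card_pos_iff]
    rw [← hcard] at hnm
    exact_mod_cast hnm
  have hk0 : 0 < k := (by positivity : 0 < 1 / (n * m)).trans_le hk
  have hT' : (0 : ℝ) < T := by exact_mod_cast hT
  obtain ⟨G, hG, hGδ, hbound⟩ := exists_measurableSet_forall_multivariateGaussian_risk_le
    (ι := (i : Fin n) × Fin (N i)) 𝒟 F hF_meas hF θstar hδ
  -- The exceptional set of the model assumptions need not be measurable, so a measurable null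
  -- superset is removed.
  obtain ⟨G', hG', hG'm, hG'0⟩ := exists_measurable_superset_of_null
    (ae_iff.1 (hA.and (hB.and (hC.and (hQ.and hcomm)))))
  refine ⟨G ∩ G'ᶜ, hG.inter hG'm.compl, ?_, ?_⟩
  · have hle : (Measure.pi fun _ => 𝒟) (G ∩ G'ᶜ)ᶜ ≤ ENNReal.ofReal δ := by
      rw [Set.compl_inter, compl_compl]
      refine (measure_union_le _ _).trans ?_
      rwa [hG'0, add_zero]
    have hreal : (Measure.pi fun _ => 𝒟).real (G ∩ G'ᶜ)ᶜ ≤ δ :=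
      ENNReal.toReal_le_of_le_ofReal hδ.le hle
    rw [probReal_compl_eq_one_sub (hG.inter hG'm.compl)] at hreal
    linarith
  · rintro s ⟨hs, hs'⟩
    obtain ⟨hAs, hBs, hCs, hQs, hcs⟩ := not_not.1 fun h => hs' (hG' h)
    obtain ⟨hV, hQV⟩ := hQs.exists_eq_multivariateGaussian (by positivity) hη (by positivity)
      hAs hBs hcs
    have ha : (T : ℝ) / n * η / (2 * (k * n * m)) = T * η / (2 * k * n ^ 2 * m) := by
      field_simp
    rw [ha] at hV hQV
    set a : ℝ := T * η / (2 * k * n ^ 2 * m) with ha_def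
    have ha0 : 0 < a := by positivity
    have hdetC : 0 < (C s * (A s)⁻¹).det := by
      rw [Matrix.det_mul]
      exact mul_pos hCs.det_pos hAs.inv.det_pos
    have hdet : (a • ((A s)⁻¹ * C s)).det = a ^ d * (C s * (A s)⁻¹).det := by
      rw [Matrix.det_smul, Fintype.card_fin, Matrix.det_mul_comm]
    have h := hbound s hs _ hV (by rw [hdet]; positivity)
    rw [← hQV, hdet, Real.log_mul (by positivity) hdetC.ne', Real.log_pow, Matrix.trace_smul,
      Matrix.trace_mul_comm, hcard, smul_eq_mul] at h
    refine h.trans_eq ?_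
    have hinv : 2 * k * (n : ℝ) ^ 2 * m / (T * η) = a⁻¹ := by rw [ha_def, inv_div]
    rw [hinv, Real.log_inv]
    congr 2 <;> ring
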